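/- Let $0<\lambda<\lambda_0:=\frac{\sqrt6-1}{5}$ and let $(p_n)_{n\ge 0}$ be a sequence of positive numbers with $p_{n+1}\le\lambda p_n$ for all $n$. Consider the infinite step billiard with table $\mathcal P=\bigcup_{n\ge 0}[n,n+1]\times[0,p_n]$: a point particle moves at unit speed in $\mathcal P$ with elastic reflections at the sides. For $\vartheta\in\,]0,\pi/2[$ consider the trajectories whose velocity takes the four values $(\pm\cos\vartheta,\pm\sin\vartheta)$, described as the flow in the constant direction $(\cos\vartheta,\sin\vartheta)$ on the invariant surface obtained by unfolding four copies of $\mathcal P$ in the plane, with coordinates $(X,Y)$, $|X|=x$, $|Y|=y$, and identifying the corresponding sides; a trajectory which reaches a reentrant corner $(k,p_k)$, $k\ge1$, is continued by continuity from above in $Y$, so that every orbit is defined for all times $t\in\mathbb R$. An orbit is called an escape orbit if its $x$-coordinate tends to $+\infty$ as $t\to+\infty$. Then for Lebesgue-almost every direction $\vartheta\in\,]0,\pi/2[$ there is exactly one escape orbit $\eta_\vartheta$ of direction $\vartheta$, and $\eta_\vartheta$ (its whole past and future) does not pass through any vertex of the table, that is, through any of the points $(0,0)$, $(0,p_0)$,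 $(n,p_n)$ and $(n,p_{n-1})$ with $n\ge 1$. -/

import Mathlib

namespace StepBilliard

/-- The infinite step table: the union over `n` of the rectangles `[n, n+1] × [0, p n]`. -/
def table (p : ℕ → ℝ) : Set (ℝ × ℝ) :=
  ⋃ n : ℕ, Set.Icc (n : ℝ) (n + 1) ×ˢ Set.Icc (0 : ℝ) (p n)

/-- All corners of the table: the two on the left wall, the reentrant (`3π/2`) corners
`(k, p k)` and the convex (`π/2`) corners `(k, p (k - 1))`, where `k = n + 1 ≥ 1`. -/
def vertices (p : ℕ → ℝ) : Set (ℝ × ℝ) :=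
  {(0, 0), (0, p 0)} ∪
    {v | ∃ n : ℕ, v = ((n : ℝ) + 1, p (n + 1)) ∨ v = ((n : ℝ) + 1, p n)}

/-- Half the height of the unfolded table over the strip `j ≤ X ≤ j + 1`: this is `p n` over
`[n, n+1]` and over its mirror image `[-(n+1), -n]`. -/
def halfHeight (p : ℕ → ℝ) : ℤ → ℝ
  | Int.ofNat n => p n
  | Int.negSucc n => p n

/-- The invariant surface, obtained by unfolding four copies of the table, in the planar
coordinates `(X, Y)`. A billiard particle at `(x, y)` moving in the direction
`(σ cos θ, τ sin θ)`, with `σ, τ = ±1`, is the point `(X, Y) = (σ x, τ y)`, so that on the surface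
it moves in the constant direction `(cos θ, sin θ)`. Horizontal sides `Y = ± p n` over the same
strip are identified with each other, and so are the walls at `X = n` and `X = - n`
(where `p n ≤ |Y| ≤ p (n-1)`). The set below keeps one representative of each regular point:
the bottom one of `Y = ± p n`, and the left one (`X = - n`) for the walls. -/
def surface (p : ℕ → ℝ) : Set (ℝ × ℝ) :=
  {z | -halfHeight p ⌊z.1⌋ ≤ z.2 ∧ z.2 < halfHeight p ⌊z.1⌋}

/-- The folding map, from the surface to the table. -/
def fold (z : ℝ × ℝ) : ℝ × ℝ := (|z.1|, |z.2|)

/-- The folding map takes the surface into the table. -/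
theorem fold_mem {p : ℕ → ℝ} {z : ℝ × ℝ} (hz : z ∈ surface p) : fold z ∈ table p := by
  obtain ⟨h1, h2⟩ := hz
  have ha := Int.floor_le z.1
  have hb := Int.lt_floor_add_one z.1
  simp only [table, Set.mem_iUnion, Set.mem_prod, Set.mem_Icc, fold]
  cases hj : ⌊z.1⌋ with
  | ofNat n =>
    rw [hj] at h1 h2 ha hb
    simp [halfHeight] at h1 h2 ha hb
    have : (0:ℝ) ≤ n := by positivity
    refine ⟨n, ⟨?_, ?_⟩, abs_nonneg _, abs_le.2 ⟨by linarith, by linarith⟩⟩ <;>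
      rw [abs_of_nonneg (by linarith)] <;> linarith
  | negSucc n =>
    rw [hj] at h1 h2 ha hb
    simp [halfHeight, Int.cast_negSucc] at h1 h2 ha hb
    have : (0:ℝ) ≤ n := by positivity
    refine ⟨n, ⟨?_, ?_⟩, abs_nonneg _, abs_le.2 ⟨by linarith, by linarith⟩⟩ <;>
      rw [abs_of_neg (by linarith)] <;> linarith

/-- Side identification for a point `z` which is the end point of a segment that travels up and to
the right inside the strip `⌈X⌉ - 1 < X < ⌈X⌉`. If it has arrived at the top side it is moved to
the bottom side; if it has arrived at a wall `X = n ≥ 1`, that is, at a point that is not in the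
aperture `{n} × [-p n, p n)`, it is moved to the mirror wall `X = - n`. At the reentrant corners
the half-open intervals implement the convention that the motion is continuous from above. -/
noncomputable def glue (p : ℕ → ℝ) (z : ℝ × ℝ) : ℝ × ℝ :=
  let y : ℝ := if z.2 = halfHeight p (⌈z.1⌉ - 1) then -z.2 else z.2
  if -halfHeight p ⌊z.1⌋ ≤ y ∧ y < halfHeight p ⌊z.1⌋ then (z.1, y) else (-z.1, y)

/-- The unit vector of direction `θ`. -/
noncomputable def direction (θ : ℝ) : ℝ × ℝ := (Real.cos θ, Real.sin θ)

/-- `γ` is a complete (two-sided) trajectory of the billiard flow of direction `θ` on the surface,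
parametrised by time: it stays on the surface; after every instant it travels for a while in a
straight line in direction `θ` at unit speed; and before every instant `t` it travelled for a while
in such a straight line, towards a point `e` that the side identifications send to `γ t`. -/
def IsTrajectory (p : ℕ → ℝ) (θ : ℝ) (γ : ℝ → ℝ × ℝ) : Prop :=
  ∀ t : ℝ, γ t ∈ surface p ∧
    (∃ ε > 0, ∀ s : ℝ, 0 ≤ s → s < ε → γ (t + s) = γ t + s • direction θ) ∧
    (∃ ε > 0, ∃ e : ℝ × ℝ,
      (∀ s : ℝ, 0 < s → s < ε → γ (t - s) = e - s • direction θ) ∧ γ t = glue p e)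

/-- `η` is an escape orbit of direction `θ`: the orbit (the set of all points, past and future) of
a trajectory whose position in the table goes to infinity along the cusp as `t → +∞`. -/
def IsEscapeOrbit (p : ℕ → ℝ) (θ : ℝ) (η : Set (ℝ × ℝ)) : Prop :=
  ∃ γ : ℝ → ℝ × ℝ, IsTrajectory p θ γ ∧ η = Set.range γ ∧
    Filter.Tendsto (fun t => (fold (γ t)).1) Filter.atTop Filter.atTop

end StepBilliard

open MeasureTheory Filter Topology

namespace StepBilliard

/-! Put α = tan θ and follow the flow on the vertical lines of integer abscissa. In the left half of
the surface the strips grow towards the right, so nothing is reflected there; a reflection occurs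
only in the right half and throws the orbit to the left half. Hence an orbit that escapes must, from
its last passage through X = 0 on, cross all apertures directly (`exists_escapesDirectly`). Its
heights form a chain with |y k| ≤ p k and y (k+1) ≡ y k + α modulo 2 p k.

Call level m good if no ray from an earlier reentrant corner reaches its aperture directly. The
aperture then pulls back to level 0 as one uncut interval of width 2 p m (`exists_isUnsplit`), and
all chains that reach it are parallel (`sub_eq_of_isUnsplit`). If infinitely many levels are good,
two chains differ at level 0 by at most 2 p m → 0, so they start at the same height
(`eq_of_linked`), and the backward orbits of the centres converge to a chain (`exists_linked`).

Almost every slope has infinitely many good levels: each further crossing at most doubles the number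
of branches of a corridor (triples it the first time), while the aperture shrinks by 0.29. In any
interval the slopes for which m is bad have proportion at most 7/10, up to an error that vanishes as
m → ∞. The slopes that are bad from some level on thus have density below 1 everywhere and form a
null set.

Finally, after i steps from a vertex an orbit has height i α + t, with t in the countable group
generated by the p n. For fixed t, n and i ≥ 1 such a ray escapes directly only for a null set of
slopes (`volume_iInter_corridor`). -/

/-! ### Measure of the slopes of directly escaping rays -/

/-- The slopes `α` for which the ray that arrives at height `i α + t` in the aperture of level `n`
passes directly through the closed apertures of the levels `n, …, n + j`. -/
def corridor (p : ℕ → ℝ) : ℕ → ℕ → ℕ → ℝ → Set ℝ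
  | 0, n, i, t => {α | |(i : ℝ) * α + t| ≤ p n}
  | j + 1, n, i, t => {α | |(i : ℝ) * α + t| ≤ p n} ∩
      ⋃ z : ℤ, corridor p j (n + 1) (i + 1) (t + 2 * p n * z)

theorem corridor_subset (p : ℕ → ℝ) (j n i : ℕ) (t : ℝ) :
    corridor p j n i t ⊆ {α | |(i : ℝ) * α + t| ≤ p n} := by
  cases j with
  | zero => exact subset_rfl
  | succ j => exact Set.inter_subset_left

/-- The indices that meet `D` lie in a window of `M + 1` integers, starting at the least of them. -/
theorem volume_inter_iUnion_le {A : ℤ → Set ℝ} {D : Set ℝ} {c : ENNReal} (M : ℕ)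
    (hA : ∀ z, volume (A z) ≤ c)
    (hM : ∀ z w, (D ∩ A z).Nonempty → (D ∩ A w).Nonempty → z - w ≤ M) :
    volume (D ∩ ⋃ z, A z) ≤ (M + 1 : ℕ) * c := by
  by_cases hne : ∃ z, (D ∩ A z).Nonempty
  · obtain ⟨z₁, hz₁⟩ := hne
    obtain ⟨z₀, hz₀, hmin⟩ := Int.exists_least_of_bdd (P := fun z => (D ∩ A z).Nonempty)
      ⟨z₁ - M, fun z hz => by have := hM z₁ z hz₁ hz; linarith⟩ ⟨z₁, hz₁⟩
    have hsub : D ∩ ⋃ z, A z ⊆ ⋃ z ∈ Finset.Icc z₀ (z₀ + M), A z := by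
      rintro x ⟨hxD, hx⟩
      obtain ⟨z, hz⟩ := Set.mem_iUnion.1 hx
      have h1 := hmin z ⟨x, hxD, hz⟩
      have h2 := hM z z₀ ⟨x, hxD, hz⟩ hz₀
      simp only [Set.mem_iUnion]
      exact ⟨z, Finset.mem_Icc.2 ⟨h1, by linarith⟩, hz⟩
    calc volume (D ∩ ⋃ z, A z) ≤ ∑ z ∈ Finset.Icc z₀ (z₀ + M), volume (A z) :=
          (measure_mono hsub).trans (measure_biUnion_finset_le _ _)
      _ ≤ (Finset.Icc z₀ (z₀ + M)).card • c := Finset.sum_le_card_nsmul _ _ _ fun z _ => hA z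
      _ = (M + 1 : ℕ) * c := by
          rw [nsmul_eq_mul, Int.card_Icc]
          congr 2
          omega
  · have : D ∩ ⋃ z, A z = ∅ := by
      rw [Set.inter_iUnion]
      exact Set.iUnion_eq_empty.2 fun z => Set.not_nonempty_iff_eq_empty.1 fun h => hne ⟨z, h⟩
    simp [this]

theorem volume_abs_le {i : ℕ} (hi : 1 ≤ i) (t r : ℝ) :
    volume {α : ℝ | |(i : ℝ) * α + t| ≤ r} ≤ ENNReal.ofReal (2 * r / i) := by
  have hi' : (0 : ℝ) < i := by exact_mod_cast hi
  have : {α : ℝ | |(i : ℝ) * α + t| ≤ r} ⊆ Set.Icc ((-t - r) / i) ((-t + r) / i) := by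
    intro α hα
    have := abs_le.1 (Set.mem_ofPred.1 hα)
    rw [Set.mem_Icc, div_le_iff₀ hi', le_div_iff₀ hi']
    constructor <;> linarith
  refine (measure_mono this).trans ?_
  rw [Real.volume_Icc]
  refine ENNReal.ofReal_le_ofReal (le_of_eq ?_)
  field_simp
  ring

variable {p : ℕ → ℝ}

/-- On the admissible slopes i α varies by at most 2 p n and α by at most p n, so the next height
varies by at most 3 p n. With the margin 2 p (n+1) ≤ 0.58 p n this is less than two periods 2 p n,
so at most two values of z occur. -/
theorem volume_corridor_of_two_le (hpos : ∀ n, 0 < p n) (hp : ∀ n, p (n + 1) ≤ 29 / 100 * p n)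
    (j n i : ℕ) (t : ℝ) (hi : 2 ≤ i) :
    volume (corridor p j n i t) ≤ ENNReal.ofReal (2 ^ j * p (n + j)) := by
  induction j generalizing n i t with
  | zero =>
    refine (volume_abs_le (by omega) t (p n)).trans (ENNReal.ofReal_le_ofReal ?_)
    have hi' : (2 : ℝ) ≤ i := by exact_mod_cast hi
    have := hpos n
    rw [div_le_iff₀ (by linarith)]
    simp
    nlinarith
  | succ j ih =>
    refine (volume_inter_iUnion_le 1 (fun z => ih (n + 1) (i + 1) _ (by omega)) ?_).trans ?_
    · rintro z w ⟨α, hα, hz⟩ ⟨β, hβ, hw⟩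
      have h1 := abs_le.1 (Set.mem_ofPred.1 hα)
      have h2 := abs_le.1 (Set.mem_ofPred.1 hβ)
      have h3 := abs_le.1 (Set.mem_ofPred.1 (corridor_subset _ _ _ _ _ hz))
      have h4 := abs_le.1 (Set.mem_ofPred.1 (corridor_subset _ _ _ _ _ hw))
      push_cast at h3 h4
      have hi' : (2 : ℝ) ≤ i := by exact_mod_cast hi
      have hpn := hpos n
      have h5 := hp n
      have h6 : β - α ≤ p n := by
        by_contra! h
        nlinarith
      have h7 : 2 * p n * ((z : ℝ) - w) < 2 * p n * 2 := by nlinarith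
      have h8 : ((z - w : ℤ) : ℝ) < (2 : ℤ) := by
        push_cast
        exact lt_of_mul_lt_mul_left h7 (by linarith)
      have := Int.cast_lt.1 h8
      push_cast
      omega
    · rw [← ENNReal.ofReal_natCast, ← ENNReal.ofReal_mul (by positivity)]
      refine ENNReal.ofReal_le_ofReal (le_of_eq ?_)
      rw [show n + 1 + j = n + (j + 1) by ring]
      push_cast
      ring

/-- For i = 1 the next height may vary by 4 p n, which allows three values of z. This happens only
at the first crossing, and 3 · 2 ^ j ≤ 2 · 2 ^ (j + 1). -/
theorem volume_corridor (hpos : ∀ n, 0 < p n) (hp : ∀ n, p (n + 1) ≤ 29 / 100 * p n)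
    (j n i : ℕ) (t : ℝ) (hi : 1 ≤ i) :
    volume (corridor p j n i t) ≤ ENNReal.ofReal (2 * 2 ^ j * p (n + j)) := by
  have hi' : (1 : ℝ) ≤ i := by exact_mod_cast hi
  cases j with
  | zero =>
    refine (volume_abs_le hi t (p n)).trans (ENNReal.ofReal_le_ofReal ?_)
    have := hpos n
    rw [div_le_iff₀ (by linarith)]
    simp
    nlinarith
  | succ j =>
    refine (volume_inter_iUnion_le 2 (fun z => volume_corridor_of_two_le hpos hp j
      (n + 1) (i + 1) _ (by omega)) ?_).trans ?_
    · rintro z w ⟨α, hα, hz⟩ ⟨β, hβ, hw⟩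
      have h1 := abs_le.1 (Set.mem_ofPred.1 hα)
      have h2 := abs_le.1 (Set.mem_ofPred.1 hβ)
      have h3 := abs_le.1 (Set.mem_ofPred.1 (corridor_subset _ _ _ _ _ hz))
      have h4 := abs_le.1 (Set.mem_ofPred.1 (corridor_subset _ _ _ _ _ hw))
      push_cast at h3 h4
      have hpn := hpos n
      have h5 := hp n
      have h6 : β - α ≤ 2 * p n := by
        by_contra! h
        nlinarith
      have h7 : 2 * p n * ((z : ℝ) - w) < 2 * p n * 3 := by nlinarith
      have h8 : ((z - w : ℤ) : ℝ) < (3 : ℤ) := by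
        push_cast
        exact lt_of_mul_lt_mul_left h7 (by linarith)
      have := Int.cast_lt.1 h8
      push_cast
      omega
    · rw [← ENNReal.ofReal_natCast, ← ENNReal.ofReal_mul (by positivity)]
      refine ENNReal.ofReal_le_ofReal ?_
      rw [show n + 1 + j = n + (j + 1) by ring]
      push_cast
      have : 0 < 2 ^ j * p (n + (j + 1)) := mul_pos (by positivity) (hpos _)
      rw [pow_succ]
      nlinarith

theorem le_pow_mul (hp : ∀ n, p (n + 1) ≤ 29 / 100 * p n) (n j : ℕ) :
    p (n + j) ≤ (29 / 100) ^ j * p n := by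
  induction j with
  | zero => simp
  | succ j ih =>
    have := hp (n + j)
    rw [← add_assoc, pow_succ]
    linarith

theorem tendsto_two_pow_mul (hpos : ∀ n, 0 < p n) (hp : ∀ n, p (n + 1) ≤ 29 / 100 * p n) (n : ℕ) :
    Tendsto (fun j : ℕ => 2 ^ j * p (n + j)) atTop (𝓝 0) := by
  have h : Tendsto (fun j : ℕ => (58 / 100 : ℝ) ^ j * p n) atTop (𝓝 0) := by
    simpa using (tendsto_pow_atTop_nhds_zero_of_lt_one (r := (58 / 100 : ℝ)) (by norm_num)
      (by norm_num)).mul_const (p n)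
  refine squeeze_zero (fun j => by have := hpos (n + j); positivity) (fun j => ?_) h
  calc 2 ^ j * p (n + j) ≤ 2 ^ j * ((29 / 100) ^ j * p n) := by gcongr; exact le_pow_mul hp n j
    _ = (58 / 100 : ℝ) ^ j * p n := by rw [← mul_assoc, ← mul_pow]; norm_num

theorem tendsto_zero (hpos : ∀ n, 0 < p n) (hp : ∀ n, p (n + 1) ≤ 29 / 100 * p n) :
    Tendsto p atTop (𝓝 0) := by
  refine squeeze_zero (fun j => (hpos j).le) (fun j => ?_) (tendsto_two_pow_mul hpos hp 0)
  rw [zero_add]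
  exact le_mul_of_one_le_left (hpos j).le (one_le_pow₀ (by norm_num))

/-- Almost no slope lets a given ray escape directly. -/
theorem volume_iInter_corridor (hpos : ∀ n, 0 < p n) (hp : ∀ n, p (n + 1) ≤ 29 / 100 * p n)
    (n i : ℕ) (t : ℝ) (hi : 1 ≤ i) : volume (⋂ j, corridor p j n i t) = 0 := by
  have h := ENNReal.tendsto_ofReal ((tendsto_two_pow_mul hpos hp n).const_mul 2)
  rw [mul_zero, ENNReal.ofReal_zero] at h
  refine le_antisymm (ge_of_tendsto' h fun j => ?_) zero_le
  rw [← mul_assoc]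
  exact (measure_mono (Set.iInter_subset _ j)).trans (volume_corridor hpos hp j n i t hi)

/-! ### Apertures missed by all corner rays -/

/-- The slopes for which the rays that leave the reentrant corners above level `k` reach the
aperture of level `k + 1 + j` directly. -/
def cornerRays (p : ℕ → ℝ) (k j : ℕ) : Set ℝ :=
  ⋃ z : ℤ, corridor p j (k + 1) 1 ((2 * z + 1) * p k)

/-- The copies (2 z + 1) p k of the corner are 2 p k apart, so about (b - a) / (2 p k) of them
matter. Since p (k+1+j) ≤ 0.29 ^ (j+1) p k, their corridors fill a fixed fraction of b - a; the
other term pays for the ends of the interval. -/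
theorem volume_Icc_inter_cornerRays (hpos : ∀ n, 0 < p n) (hp : ∀ n, p (n + 1) ≤ 29 / 100 * p n)
    (k j : ℕ) {a b : ℝ} (hab : a ≤ b) :
    volume (Set.Icc a b ∩ cornerRays p k j) ≤
      ENNReal.ofReal ((b - a) * (29 / 100 * (58 / 100) ^ j) + 4 * 2 ^ j * p (k + 1 + j)) := by
  have hpk := hpos k
  have hx : 0 ≤ (b - a) / (2 * p k) + 1 := by
    have : 0 ≤ (b - a) / (2 * p k) := div_nonneg (by linarith) (by linarith)
    linarith
  refine (volume_inter_iUnion_le ⌊(b - a) / (2 * p k) + 1⌋₊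
    (fun z => volume_corridor hpos hp j (k + 1) 1 _ le_rfl) ?_).trans ?_
  · rintro z w ⟨α, hα, hz⟩ ⟨β, hβ, hw⟩
    have h3 := abs_le.1 (Set.mem_ofPred.1 (corridor_subset _ _ _ _ _ hz))
    have h4 := abs_le.1 (Set.mem_ofPred.1 (corridor_subset _ _ _ _ _ hw))
    push_cast at h3 h4
    have h5 := hp k
    have h7 : ((z - w : ℤ) : ℝ) ≤ (b - a) / (2 * p k) + 1 := by
      rw [← sub_le_iff_le_add, le_div_iff₀ (by linarith)]
      push_cast
      nlinarith [hα.1, hα.2, hβ.1, hβ.2]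
    rw [← Int.le_floor] at h7
    rwa [Int.natCast_floor_eq_floor hx]
  · rw [← ENNReal.ofReal_natCast, ← ENNReal.ofReal_mul (by positivity)]
    refine ENNReal.ofReal_le_ofReal ?_
    push_cast
    have hf := Nat.floor_le hx
    have hq : p (k + 1 + j) ≤ 29 / 100 * (29 / 100) ^ j * p k := by
      have := le_pow_mul hp k (1 + j)
      rwa [pow_add, pow_one, ← add_assoc] at this
    have h2 : (58 / 100 : ℝ) ^ j = 2 ^ j * (29 / 100) ^ j := by rw [← mul_pow]; norm_num
    have h3 : 0 < 2 * 2 ^ j * p (k + 1 + j) := mul_pos (by positivity) (hpos _)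
    calc _ ≤ ((b - a) / (2 * p k) + 2) * (2 * 2 ^ j * p (k + 1 + j)) := by
          exact mul_le_mul_of_nonneg_right (by linarith) h3.le
      _ = (b - a) / (2 * p k) * (2 * 2 ^ j) * p (k + 1 + j) + 4 * 2 ^ j * p (k + 1 + j) := by ring
      _ ≤ (b - a) / (2 * p k) * (2 * 2 ^ j) * (29 / 100 * (29 / 100) ^ j * p k)
          + 4 * 2 ^ j * p (k + 1 + j) := by
        have : 0 ≤ (b - a) / (2 * p k) := div_nonneg (by linarith) (by linarith)
        gcongr
      _ = _ := by
        rw [h2]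
        field_simp

theorem volume_Icc_inter_iUnion_cornerRays (hpos : ∀ n, 0 < p n)
    (hp : ∀ n, p (n + 1) ≤ 29 / 100 * p n) (m : ℕ) {a b : ℝ} (hab : a ≤ b) :
    volume (Set.Icc a b ∩ ⋃ j ∈ Finset.range m, cornerRays p (m - 1 - j) j) ≤
      ENNReal.ofReal ((b - a) * (7 / 10) + 4 * (2 ^ m * p m)) := by
  -- The constant 7/10 works because 7/10 · (1 - 0.58) = 0.294 ≥ 0.29.
  have hsum : ∀ n : ℕ, ∑ j ∈ Finset.range n,
      ((b - a) * (29 / 100 * (58 / 100) ^ j) + 4 * 2 ^ j * p m) ≤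
      (b - a) * (7 / 10 * (1 - (58 / 100) ^ n)) + 4 * (2 ^ n - 1) * p m := by
    intro n
    induction n with
    | zero => simp
    | succ n ih =>
      rw [Finset.sum_range_succ, pow_succ, pow_succ]
      have h1 : 0 ≤ (b - a) * (58 / 100) ^ n := mul_nonneg (by linarith) (by positivity)
      nlinarith
  rw [Set.inter_iUnion₂]
  refine (measure_biUnion_finset_le _ _).trans ?_
  calc _ ≤ ∑ j ∈ Finset.range m,
        ENNReal.ofReal ((b - a) * (29 / 100 * (58 / 100) ^ j) + 4 * 2 ^ j * p m) := by
        refine Finset.sum_le_sum fun j hj => ?_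
        have h := volume_Icc_inter_cornerRays hpos hp (m - 1 - j) j hab
        have hj := Finset.mem_range.1 hj
        rwa [show m - 1 - j + 1 + j = m by omega] at h
    _ = ENNReal.ofReal (∑ j ∈ Finset.range m,
        ((b - a) * (29 / 100 * (58 / 100) ^ j) + 4 * 2 ^ j * p m)) := by
        rw [ENNReal.ofReal_sum_of_nonneg]
        intro j _
        have := hpos m
        have := sub_nonneg.2 hab
        positivity
    _ ≤ _ := by
        refine ENNReal.ofReal_le_ofReal ((hsum m).trans ?_)
        have h1 : 0 ≤ (b - a) * (58 / 100) ^ m := mul_nonneg (by linarith) (by positivity)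
        have := hpos m
        nlinarith

/-- By the Lebesgue density theorem almost every point of `s` has density 1, while the hypothesis
keeps all densities below 4/5. -/
theorem volume_eq_zero_of_inter_Icc_le {s : Set ℝ}
    (h : ∀ a b : ℝ, a < b → volume (s ∩ Set.Icc a b) ≤ ENNReal.ofReal (4 / 5 * (b - a))) :
    volume s = 0 := by
  by_contra hs
  have hd := Besicovitch.ae_tendsto_measure_inter_div (volume : Measure ℝ) s
  have : (ae (volume.restrict s)).NeBot := by
    rw [ae_neBot]
    simpa using hs
  obtain ⟨x, hx⟩ := hd.exists
  have hle : (1 : ENNReal) ≤ ENNReal.ofReal (4 / 5) := by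
    refine le_of_tendsto hx ?_
    filter_upwards [self_mem_nhdsWithin] with r hr
    have hr : 0 < r := hr
    rw [Real.closedBall_eq_Icc, Real.volume_Icc]
    refine ENNReal.div_le_of_le_mul ((h _ _ (by linarith)).trans (le_of_eq ?_))
    rw [← ENNReal.ofReal_mul (by norm_num)]
  rw [← ENNReal.ofReal_one, ENNReal.ofReal_le_ofReal_iff (by norm_num)] at hle
  norm_num at hle

/-- For almost every slope there are infinitely many apertures which no ray from a previous
reentrant corner reaches directly. -/
theorem ae_frequently_forall_notMem_cornerRays (hpos : ∀ n, 0 < p n)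
    (hp : ∀ n, p (n + 1) ≤ 29 / 100 * p n) :
    ∀ᵐ α : ℝ, ∃ᶠ m : ℕ in atTop, ∀ k j, k + 1 + j = m → α ∉ cornerRays p k j := by
  have key : ∀ M : ℕ, volume {α : ℝ | ∀ m ≥ M,
      α ∈ ⋃ j ∈ Finset.range m, cornerRays p (m - 1 - j) j} = 0 := by
    refine fun M => volume_eq_zero_of_inter_Icc_le fun a b hab => ?_
    have ht : Tendsto (fun m : ℕ => (b - a) * (7 / 10) + 4 * (2 ^ m * p m)) atTop
        (𝓝 ((b - a) * (7 / 10))) := by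
      simpa using ((tendsto_two_pow_mul hpos hp 0).const_mul 4).const_add ((b - a) * (7 / 10))
    -- The gap between 7/10 and 4/5 absorbs the error term once m is large, depending on the
    -- interval.
    obtain ⟨m, hm, hmM⟩ := ((ht.eventually (ge_mem_nhds
      (show (b - a) * (7 / 10) < 4 / 5 * (b - a) by linarith))).and
      (eventually_ge_atTop M)).exists
    refine le_trans (measure_mono ?_)
      ((volume_Icc_inter_iUnion_cornerRays hpos hp m hab.le).trans (ENNReal.ofReal_le_ofReal hm))
    rintro α ⟨h1, h2⟩
    exact ⟨h2, h1 m hmM⟩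
  have : ∀ᵐ α : ℝ, ∀ M : ℕ, ¬ ∀ m ≥ M, α ∈ ⋃ j ∈ Finset.range m, cornerRays p (m - 1 - j) j := by
    rw [ae_all_iff]
    intro M
    rw [ae_iff]
    simpa only [not_not] using key M
  filter_upwards [this] with α hα
  rw [frequently_atTop]
  intro M
  have h := hα M
  push Not at h
  obtain ⟨m, hm, hmem⟩ := h
  refine ⟨m, hm, fun k j hkj hmem' => hmem ?_⟩
  simp only [Set.mem_iUnion]
  refine ⟨j, Finset.mem_range.2 (by omega), ?_⟩
  rwa [show m - 1 - j = k by omega]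

/-! ### Chains of heights: existence and uniqueness -/

variable {α θ : ℝ}

/-- The step relation of the heights of a directly escaping orbit at consecutive apertures. -/
def Linked (p : ℕ → ℝ) (α : ℝ) (c : ℕ → ℝ) (k : ℕ) : Prop :=
  ∃ z : ℤ, c (k + 1) = c k + α + 2 * p k * z

/-- The aperture of level `m` is pulled back to level `l` without being split by a corner; `c` is
the backward orbit of its centre. -/
def IsUnsplit (p : ℕ → ℝ) (α : ℝ) (l m : ℕ) (c : ℕ → ℝ) : Prop :=
  c m = 0 ∧ ∀ k, l ≤ k → k < m → |c k| < p k - p m ∧ Linked p α c k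

theorem mem_corridor_of_linked {c : ℕ → ℝ} {n j : ℕ} (hc : ∀ k, n ≤ k → k ≤ n + j → |c k| ≤ p k)
    (hl : ∀ k, n ≤ k → k < n + j → Linked p α c k) {i : ℕ} {t : ℝ} (h : c n = i * α + t) :
    α ∈ corridor p j n i t := by
  have h0 : α ∈ {α | |(i : ℝ) * α + t| ≤ p n} := by
    rw [Set.mem_ofPred_eq, ← h]
    exact hc n le_rfl (by omega)
  induction j generalizing n i t with
  | zero => exact h0
  | succ j ih =>
    refine ⟨h0, ?_⟩
    obtain ⟨z, hz⟩ := hl n le_rfl (by omega)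
    have h1 : c (n + 1) = ((i + 1 : ℕ) : ℝ) * α + (t + 2 * p n * z) := by
      rw [hz, h]; push_cast; ring
    refine Set.mem_iUnion.2 ⟨z, ih (fun k hk hk' => hc k (by omega) (by omega))
      (fun k hk hk' => hl k (by omega) (by omega)) h1 ?_⟩
    rw [Set.mem_ofPred_eq, ← h1]
    exact hc _ (by omega) (by omega)

/-- A translate of `c` by at most p m keeps the links, and the room p m left around `c` keeps it
inside the apertures. -/
theorem mem_corridor_of_isUnsplit {c : ℕ → ℝ} {n j : ℕ}
    (hc : IsUnsplit p α n (n + j) c) {i : ℕ} {t : ℝ} (h : |c n - (i * α + t)| ≤ p (n + j)) :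
    α ∈ corridor p j n i t := by
  refine mem_corridor_of_linked (c := fun k => c k - (c n - (i * α + t))) ?_ ?_ (by ring)
  · intro k hk hk'
    rcases hk'.eq_or_lt with rfl | hk'
    · rw [hc.1, zero_sub, abs_neg]
      exact h
    · have := (hc.2 k hk hk').1
      exact (abs_sub _ _).trans (by linarith)
  · intro k hk hk'
    obtain ⟨z, hz⟩ := (hc.2 k hk hk').2
    exact ⟨z, by dsimp only; rw [hz]; ring⟩

/-- The representative of `y` modulo `2 h` in `[-h, h)`. -/
noncomputable def wrap (h y : ℝ) : ℝ := y - 2 * h * ⌊(y + h) / (2 * h)⌋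

theorem wrap_mem {h : ℝ} (hh : 0 < h) (y : ℝ) : -h ≤ wrap h y ∧ wrap h y < h := by
  have h1 := Int.floor_le ((y + h) / (2 * h))
  have h2 := Int.lt_floor_add_one ((y + h) / (2 * h))
  rw [le_div_iff₀ (by linarith)] at h1
  rw [div_lt_iff₀ (by linarith)] at h2
  unfold wrap
  constructor <;> linarith

theorem exists_wrap_eq (h y : ℝ) : ∃ z : ℤ, wrap h y = y + 2 * h * z :=
  ⟨-⌊(y + h) / (2 * h)⌋, by rw [wrap]; push_cast; ring⟩

theorem wrap_eq {h y w : ℝ} (hw : -h ≤ w ∧ w < h) (z : ℤ) (hz : w = y + 2 * h * z) :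
    wrap h y = w := by
  have hh : 0 < h := by linarith
  have : ⌊(y + h) / (2 * h)⌋ = -z := by
    rw [Int.floor_eq_iff, le_div_iff₀ (by linarith), div_lt_iff₀ (by linarith)]
    push_cast
    constructor <;> linarith
  rw [wrap, this, hz]
  push_cast
  ring

/-- Pull the centre back one level. Were it within p m of the edge, the parallel ray from the corner
there would reach the aperture of level m. -/
theorem exists_isUnsplit (hpos : ∀ n, 0 < p n) {m : ℕ}
    (h : ∀ k j, k + 1 + j = m → α ∉ cornerRays p k j) {l : ℕ} (hl : l ≤ m) :
    ∃ c, IsUnsplit p α l m c := by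
  induction hl using Nat.decreasingInduction with
  | self => exact ⟨fun _ => 0, rfl, fun k h1 h2 => absurd h1 (by omega)⟩
  | of_succ l hl ih =>
    obtain ⟨c, hc⟩ := ih
    obtain ⟨z, hz⟩ := exists_wrap_eq (p l) (c (l + 1) - α)
    obtain ⟨h1, h2⟩ := wrap_mem (hpos l) (c (l + 1) - α)
    set w := wrap (p l) (c (l + 1) - α)
    refine ⟨Function.update c l w, ?_, fun k hk hk' => ?_⟩
    · rw [Function.update_of_ne (by omega)]
      exact hc.1
    rcases hk.eq_or_lt with rfl | hk
    swap
    · have := hc.2 k hk hk'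
      rw [Linked, Function.update_of_ne (by omega), Function.update_of_ne (by omega)]
      exact this
    rw [Linked, Function.update_self, Function.update_of_ne (by omega)]
    refine ⟨?_, -z, by rw [hz]; push_cast; ring⟩
    by_contra! hge
    obtain ⟨j, rfl⟩ : ∃ j, m = l + 1 + j := ⟨m - (l + 1), by omega⟩
    refine h l j rfl (Set.mem_iUnion.2 ?_)
    -- Upper corner p l in the first case, lower corner -p l in the second; they differ by one
    -- period.
    rcases le_abs.1 hge with hge | hge
    · refine ⟨-z, mem_corridor_of_isUnsplit hc (abs_le.2 ?_)⟩
      push_cast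
      constructor <;> linarith [hpos (l + 1 + j)]
    · refine ⟨-z - 1, mem_corridor_of_isUnsplit hc (abs_le.2 ?_)⟩
      push_cast
      constructor <;> linarith [hpos (l + 1 + j)]

/-- A chain through the closed apertures up to an unsplit one is parallel to the backward orbit of
the centre of the latter. -/
theorem sub_eq_of_isUnsplit (hpos : ∀ n, 0 < p n) {m : ℕ} {c y : ℕ → ℝ}
    (hc : IsUnsplit p α 0 m c) (hy : ∀ k ≤ m, |y k| ≤ p k) (hl : ∀ k < m, Linked p α y k)
    {k : ℕ} (hk : k ≤ m) : y k - c k = y m := by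
  induction hk using Nat.decreasingInduction with
  | self => rw [hc.1, sub_zero]
  | of_succ k hk ih =>
    obtain ⟨h1, z, hz⟩ := hc.2 k (Nat.zero_le _) hk
    obtain ⟨w, hw⟩ := hl k hk
    have h2 := abs_lt.1 h1
    have h3 := abs_le.1 (hy k hk.le)
    have h4 := abs_le.1 (hy m le_rfl)
    have hpk := hpos k
    -- The quantity 2 p k (w - z) equals y m - (y k - c k), whose absolute value is less than p m +
    -- p k + (p k - p m) = 2 p k.
    have h5 : 2 * p k * ((w - z : ℤ) : ℝ) < 2 * p k * ((1 : ℤ) : ℝ) := by push_cast; linarith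
    have h6 : 2 * p k * ((-1 : ℤ) : ℝ) < 2 * p k * ((w - z : ℤ) : ℝ) := by push_cast; linarith
    have h7 := Int.cast_lt.1 (lt_of_mul_lt_mul_left h5 (by linarith))
    have h8 := Int.cast_lt.1 (lt_of_mul_lt_mul_left h6 (by linarith))
    obtain rfl : w = z := by omega
    linarith

theorem eq_of_linked (hpos : ∀ n, 0 < p n) (h0 : Tendsto p atTop (𝓝 0))
    (hα : ∃ᶠ m in atTop, ∃ c, IsUnsplit p α 0 m c) {y y' : ℕ → ℝ}
    (hy : ∀ k, |y k| ≤ p k) (hl : ∀ k, Linked p α y k)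
    (hy' : ∀ k, |y' k| ≤ p k) (hl' : ∀ k, Linked p α y' k) : y 0 = y' 0 := by
  by_contra hne
  have hpos' : 0 < |y 0 - y' 0| / 2 := half_pos (abs_pos.2 (sub_ne_zero.2 hne))
  obtain ⟨m, ⟨c, hc⟩, hm⟩ := (hα.and_eventually (h0.eventually_lt_const hpos')).exists
  have h1 := sub_eq_of_isUnsplit hpos hc (fun k _ => hy k) (fun k _ => hl k) (Nat.zero_le m)
  have h2 := sub_eq_of_isUnsplit hpos hc (fun k _ => hy' k) (fun k _ => hl' k) (Nat.zero_le m)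
  have h3 : y 0 - y' 0 = y m - y' m := by linarith
  have h4 := (abs_sub (y m) (y' m)).trans (add_le_add (hy m) (hy' m))
  rw [h3] at hm
  linarith

/-- Centres of later unsplit levels stay within p (φ i) of the i-th one, so they converge at each
level. The strict room in `IsUnsplit` puts the limit in the open apertures, where the half-open
corner convention plays no role. -/
theorem exists_linked (hpos : ∀ n, 0 < p n) (h0 : Tendsto p atTop (𝓝 0))
    (hα : ∃ᶠ m in atTop, ∃ c, IsUnsplit p α 0 m c) :
    ∃ y : ℕ → ℝ, ∀ k, |y k| < p k ∧ Linked p α y k := by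
  obtain ⟨φ, hφ, hc⟩ := extraction_of_frequently_atTop hα
  choose c hc using hc
  have hle : ∀ i k, k ≤ φ i → |c i k| ≤ p k := by
    intro i k hk
    rcases hk.eq_or_lt with rfl | hk
    · rw [(hc i).1, abs_zero]; exact (hpos _).le
    · linarith [((hc i).2 k (Nat.zero_le _) hk).1, hpos (φ i)]
  have hpar : ∀ i j k, i ≤ j → k ≤ φ i → c j k - c i k = c j (φ i) := by
    intro i j k hij hk
    have hij' := hφ.monotone hij
    exact sub_eq_of_isUnsplit hpos (hc i) (fun n hn => hle j n (hn.trans hij'))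
      (fun n hn => ((hc j).2 n (Nat.zero_le _) (hn.trans_le hij')).2) hk
  have hdist : ∀ i j k, i ≤ j → k ≤ φ i → |c j k - c i k| ≤ p (φ i) := by
    intro i j k hij hk
    rw [hpar i j k hij hk]
    exact hle j _ (hφ.monotone hij)
  have hcau : ∀ k, CauchySeq fun i => c i k := by
    intro k
    rw [Metric.cauchySeq_iff']
    intro ε hε
    obtain ⟨N, h1, h2⟩ := (((h0.comp hφ.tendsto_atTop).eventually_lt_const hε).and
      (hφ.tendsto_atTop.eventually_ge_atTop k)).exists
    exact ⟨N, fun n hn => (hdist N n k hn h2).trans_lt h1⟩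
  choose y hy using fun k => cauchySeq_tendsto_of_complete (hcau k)
  refine ⟨y, fun k => ?_⟩
  obtain ⟨i, hi⟩ := (hφ.tendsto_atTop.eventually_gt_atTop k).exists
  obtain ⟨h1, z, hz⟩ := (hc i).2 k (Nat.zero_le _) hi
  constructor
  · have h2 : |y k - c i k| ≤ p (φ i) := by
      refine le_of_tendsto ((hy k).sub_const (c i k)).abs ?_
      filter_upwards [eventually_ge_atTop i] with j hj using hdist i j k hj hi.le
    have h3 := abs_add_le (y k - c i k) (c i k)
    rw [sub_add_cancel] at h3
    linarith
  · refine ⟨z, ?_⟩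
    -- The backward orbits are parallel, so this difference does not depend on j ≥ i and the integer
    -- z survives in the limit.
    have h2 : Tendsto (fun j => c j (k + 1) - c j k) atTop (𝓝 (α + 2 * p k * z)) := by
      refine tendsto_const_nhds.congr' ?_
      filter_upwards [eventually_ge_atTop i] with j hj
      have h3 := hpar i j k hj hi.le
      have h4 := hpar i j (k + 1) hj hi
      linarith
    have := tendsto_nhds_unique h2 ((hy (k + 1)).sub (hy k))
    linarith

/-! ### The return map and the flow built from it -/

theorem halfHeight_pos (hpos : ∀ n, 0 < p n) (k : ℤ) : 0 < halfHeight p k := by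
  cases k <;> exact hpos _

theorem halfHeight_neg (p : ℕ → ℝ) (k : ℤ) : halfHeight p (-(k + 1)) = halfHeight p k := by
  cases k with
  | ofNat n => rfl
  | negSucc n =>
    rw [show -(Int.negSucc n + 1) = Int.ofNat n by simp [Int.negSucc_eq]]
    rfl

/-- A point of the surface with integer abscissa: the beginning of the crossing of a strip. -/
abbrev State (p : ℕ → ℝ) : Type :=
  {s : ℤ × ℝ // -halfHeight p s.1 ≤ s.2 ∧ s.2 < halfHeight p s.1}

open Classical in
/-- The first return map of the flow with slope `α` to the vertical lines of integer abscissa. -/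
noncomputable def step (hpos : ∀ n, 0 < p n) (α : ℝ) : Equiv.Perm (State p) where
  toFun s :=
    if h : -halfHeight p (s.1.1 + 1) ≤ wrap (halfHeight p s.1.1) (s.1.2 + α) ∧
        wrap (halfHeight p s.1.1) (s.1.2 + α) < halfHeight p (s.1.1 + 1)
    then ⟨(s.1.1 + 1, wrap (halfHeight p s.1.1) (s.1.2 + α)), h⟩
    else ⟨(-(s.1.1 + 1), wrap (halfHeight p s.1.1) (s.1.2 + α)), by
      dsimp only
      rw [halfHeight_neg]
      exact wrap_mem (halfHeight_pos hpos _) _⟩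
  invFun s :=
    if -halfHeight p (s.1.1 - 1) ≤ s.1.2 ∧ s.1.2 < halfHeight p (s.1.1 - 1)
    then ⟨(s.1.1 - 1, wrap (halfHeight p (s.1.1 - 1)) (s.1.2 - α)),
      wrap_mem (halfHeight_pos hpos _) _⟩
    -- A wall point at X = k was reached at X = -k, the right end of strip -(k + 1), the mirror
    -- image of strip k.
    else ⟨(-(s.1.1 + 1), wrap (halfHeight p (-(s.1.1 + 1))) (s.1.2 - α)),
      wrap_mem (halfHeight_pos hpos _) _⟩
  left_inv := by
    rintro ⟨⟨k, y⟩, hy⟩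
    obtain ⟨z, hz⟩ := exists_wrap_eq (halfHeight p k) (y + α)
    have hw := wrap_mem (halfHeight_pos hpos k) (y + α)
    have hback : wrap (halfHeight p k) (wrap (halfHeight p k) (y + α) - α) = y :=
      wrap_eq hy (-z) (by rw [hz]; push_cast; ring)
    by_cases h : -halfHeight p (k + 1) ≤ wrap (halfHeight p k) (y + α) ∧
        wrap (halfHeight p k) (y + α) < halfHeight p (k + 1)
    · simp [h, hw, hback]
    · have e : -(k + 1) - 1 = -((k + 1) + 1) := by ring
      simp only [h, dite_false, e, halfHeight_neg, if_false]
      simp [hback]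
  right_inv := by
    rintro ⟨⟨k, y⟩, hy⟩
    have hy1 : -halfHeight p k ≤ y := hy.1
    have hy2 : y < halfHeight p k := hy.2
    by_cases h : -halfHeight p (k - 1) ≤ y ∧ y < halfHeight p (k - 1)
    · obtain ⟨z, hz⟩ := exists_wrap_eq (halfHeight p (k - 1)) (y - α)
      have hback : wrap (halfHeight p (k - 1)) (wrap (halfHeight p (k - 1)) (y - α) + α) = y :=
        wrap_eq h (-z) (by rw [hz]; push_cast; ring)
      simp [h, hback, hy1, hy2]
    · obtain ⟨z, hz⟩ := exists_wrap_eq (halfHeight p k) (y - α)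
      have hback : wrap (halfHeight p k) (wrap (halfHeight p k) (y - α) + α) = y :=
        wrap_eq hy (-z) (by rw [hz]; push_cast; ring)
      have e : -(k + 1) + 1 = -((k - 1) + 1) := by ring
      simp only [h, if_false, halfHeight_neg, hback, e, dite_false]
      simp

theorem coe_step (hpos : ∀ n, 0 < p n) (α : ℝ) (s : State p) :
    (step hpos α s).1 =
      if -halfHeight p (s.1.1 + 1) ≤ wrap (halfHeight p s.1.1) (s.1.2 + α) ∧
        wrap (halfHeight p s.1.1) (s.1.2 + α) < halfHeight p (s.1.1 + 1)
      then (s.1.1 + 1, wrap (halfHeight p s.1.1) (s.1.2 + α))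
      else (-(s.1.1 + 1), wrap (halfHeight p s.1.1) (s.1.2 + α)) := by
  rw [step, Equiv.coe_fn_mk]
  split_ifs <;> rfl

/-- The position of the particle that crosses the strip of `s`, at horizontal distance `u` from
the beginning of the strip. -/
noncomputable def glide (α : ℝ) (s : State p) (u : ℝ) : ℝ × ℝ :=
  (s.1.1 + u, wrap (halfHeight p s.1.1) (s.1.2 + u * α))

/-- The billiard flow on the orbits which are at `s` at time `0`. -/
noncomputable def flow (hpos : ∀ n, 0 < p n) (θ : ℝ) (s : State p) (t : ℝ) : ℝ × ℝ :=
  glide (Real.tan θ) ((step hpos (Real.tan θ) ^ ⌊t * Real.cos θ⌋) s) (Int.fract (t * Real.cos θ))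

theorem flow_eq (hpos : ∀ n, 0 < p n) (s : State p) {t u : ℝ} {N : ℤ}
    (h : t * Real.cos θ = N + u) (h0 : 0 ≤ u) (h1 : u < 1) :
    flow hpos θ s t = glide (Real.tan θ) ((step hpos (Real.tan θ) ^ N) s) u := by
  have hN : ⌊t * Real.cos θ⌋ = N := by
    rw [Int.floor_eq_iff]
    constructor <;> linarith
  rw [flow, Int.fract, hN, h, add_sub_cancel_left]

theorem glide_zero (α : ℝ) (s : State p) : glide α s 0 = ((s.1.1 : ℝ), s.1.2) := by
  rw [glide, add_zero, zero_mul, add_zero, wrap_eq s.2 0 (by simp)]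

theorem flow_zpow (hpos : ∀ n, 0 < p n) (hc : 0 < Real.cos θ) (s : State p) (N : ℤ) (t : ℝ) :
    flow hpos θ ((step hpos (Real.tan θ) ^ N) s) t = flow hpos θ s (t + N / Real.cos θ) := by
  have h : (t + N / Real.cos θ) * Real.cos θ = ((⌊t * Real.cos θ⌋ + N : ℤ) : ℝ) +
      Int.fract (t * Real.cos θ) := by
    rw [add_mul, div_mul_cancel₀ _ hc.ne']
    push_cast
    linarith [Int.floor_add_fract (t * Real.cos θ)]
  rw [flow_eq hpos s h (Int.fract_nonneg _) (Int.fract_lt_one _), flow, zpow_add,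
    Equiv.Perm.mul_apply]

theorem floor_int_add {u : ℝ} (k : ℤ) (h0 : 0 ≤ u) (h1 : u < 1) : ⌊(k : ℝ) + u⌋ = k := by
  rw [Int.floor_eq_iff]
  constructor <;> linarith

theorem ceil_int_add_sub_one {u : ℝ} (k : ℤ) (h0 : 0 < u) (h1 : u ≤ 1) :
    ⌈(k : ℝ) + u⌉ - 1 = k := by
  have : ⌈(k : ℝ) + u⌉ = k + 1 := by
    rw [Int.ceil_eq_iff]
    push_cast
    constructor <;> linarith
  omega

theorem isTrajectory_flow (hpos : ∀ n, 0 < p n) (hc : 0 < Real.cos θ) (hs : 0 < Real.sin θ)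
    (s : State p) : IsTrajectory p θ (flow hpos θ s) := by
  have htan : Real.cos θ * Real.tan θ = Real.sin θ := by
    rw [mul_comm, Real.tan_mul_cos hc.ne']
  intro t
  refine ⟨?_, ?_, ?_⟩
  · rw [flow, glide, surface, Set.mem_ofPred_eq]
    dsimp only
    rw [floor_int_add _ (Int.fract_nonneg _) (Int.fract_lt_one _)]
    exact wrap_mem (halfHeight_pos hpos _) _
  · have h0 := Int.fract_nonneg (t * Real.cos θ)
    have h1 := Int.fract_lt_one (t * Real.cos θ)
    have hN := Int.floor_add_fract (t * Real.cos θ)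
    rw [flow]
    set u := Int.fract (t * Real.cos θ)
    set N := ⌊t * Real.cos θ⌋
    set σ := (step hpos (Real.tan θ) ^ N) s with hσ
    set H := halfHeight p σ.1.1 with hH
    have hHpos : 0 < H := halfHeight_pos hpos _
    obtain ⟨z, hz⟩ := exists_wrap_eq H (σ.1.2 + u * Real.tan θ)
    obtain ⟨hw1, hw2⟩ := wrap_mem hHpos (σ.1.2 + u * Real.tan θ)
    have hg : glide (Real.tan θ) σ u = (σ.1.1 + u, wrap H (σ.1.2 + u * Real.tan θ)) := rfl
    rw [hg]
    set Y := wrap H (σ.1.2 + u * Real.tan θ) with hY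
    refine ⟨min ((1 - u) / Real.cos θ) ((H - Y) / Real.sin θ),
      lt_min (div_pos (by linarith) hc) (div_pos (by linarith) hs), fun r hr0 hr => ?_⟩
    obtain ⟨hr1, hr2⟩ := lt_min_iff.1 hr
    rw [lt_div_iff₀ hc] at hr1
    rw [lt_div_iff₀ hs] at hr2
    have hrc : 0 ≤ r * Real.cos θ := mul_nonneg hr0 hc.le
    have hrs : 0 ≤ r * Real.sin θ := mul_nonneg hr0 hs.le
    rw [flow_eq hpos s (t := t + r) (u := u + r * Real.cos θ) (N := N) (by linarith)
      (by linarith) (by linarith), ← hσ, glide, ← hH,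
      wrap_eq (w := Y + r * Real.sin θ) ⟨by linarith, by linarith⟩ z
        (by rw [hz, ← htan]; ring)]
    simp only [direction, Prod.smul_mk, smul_eq_mul, Prod.mk_add_mk, add_assoc]
  -- With the ceiling u lies in (0, 1], so the immediate past of t belongs to a single crossing even
  -- if t is at an integer line.
  · set N := ⌈t * Real.cos θ⌉ - 1 with hNdef
    obtain ⟨u, hu⟩ : ∃ u, t * Real.cos θ = N + u := ⟨t * Real.cos θ - N, by ring⟩
    have h0 : 0 < u := by
      have := Int.ceil_lt_add_one (t * Real.cos θ)
      have hN : (N : ℝ) = ⌈t * Real.cos θ⌉ - 1 := by rw [hNdef]; push_cast; ring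
      linarith
    have h1 : u ≤ 1 := by
      have := Int.le_ceil (t * Real.cos θ)
      have hN : (N : ℝ) = ⌈t * Real.cos θ⌉ - 1 := by rw [hNdef]; push_cast; ring
      linarith
    clear_value N
    set σ := (step hpos (Real.tan θ) ^ N) s with hσ
    set H := halfHeight p σ.1.1 with hH
    have hHpos : 0 < H := halfHeight_pos hpos _
    obtain ⟨z, hz⟩ := exists_wrap_eq H (-(σ.1.2 + u * Real.tan θ))
    obtain ⟨hw1, hw2⟩ := wrap_mem hHpos (-(σ.1.2 + u * Real.tan θ))
    -- This representative lies in (-H, H]: the height of arrival, before the top side is identified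
    -- with the bottom.
    obtain ⟨Y, hY⟩ : ∃ Y, Y = -wrap H (-(σ.1.2 + u * Real.tan θ)) := ⟨_, rfl⟩
    refine ⟨min (u / Real.cos θ) ((Y + H) / Real.sin θ),
      lt_min (div_pos (by linarith) hc) (div_pos (by linarith) hs), (σ.1.1 + u, Y),
      fun r hr0 hr => ?_, ?_⟩
    · obtain ⟨hr1, hr2⟩ := lt_min_iff.1 hr
      rw [lt_div_iff₀ hc] at hr1
      rw [lt_div_iff₀ hs] at hr2
      have hrc : 0 < r * Real.cos θ := mul_pos hr0 hc
      have hrs : 0 < r * Real.sin θ := mul_pos hr0 hs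
      rw [flow_eq hpos s (t := t - r) (u := u - r * Real.cos θ) (N := N) (by linarith)
        (by linarith) (by linarith), ← hσ, glide, ← hH,
        wrap_eq (w := Y - r * Real.sin θ) ⟨by linarith, by linarith⟩ (-z)
          (by rw [hY, hz, ← htan]; push_cast; ring)]
      simp only [direction, Prod.smul_mk, smul_eq_mul, Prod.mk_sub_mk, add_sub_assoc]
    · have hy : (if Y = H then -Y else Y) = wrap H (σ.1.2 + u * Real.tan θ) := by
        symm
        split_ifs with hYH
        · refine wrap_eq ⟨by linarith, by linarith⟩ (-z - 1) ?_
          have : Y = σ.1.2 + u * Real.tan θ - 2 * H * z := by rw [hY, hz]; ring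
          push_cast
          linarith
        · refine wrap_eq ⟨by linarith, lt_of_le_of_ne (by linarith) hYH⟩ (-z) ?_
          rw [hY, hz]; push_cast; ring
      rw [glue]
      dsimp only
      rw [ceil_int_add_sub_one _ h0 h1, ← hH, hy]
      rcases h1.eq_or_lt with rfl | h1
      · rw [flow_eq hpos s (t := t) (u := 0) (N := 1 + N) (by push_cast; linarith) le_rfl one_pos,
          zpow_add, zpow_one, Equiv.Perm.mul_apply, ← hσ, glide_zero, coe_step, one_mul,
          show ((σ.1.1 : ℝ) + 1) = ((σ.1.1 + 1 : ℤ) : ℝ) by push_cast; rfl, Int.floor_intCast, ← hH]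
        split_ifs <;> simp
      · rw [flow_eq hpos s hu h0.le h1, ← hσ, floor_int_add _ h0.le h1, ← hH,
          if_pos (wrap_mem hHpos _)]
        rfl

/-! ### Determinism of trajectories -/

/-- This gives uniqueness of the past. A clash could only be between a passage through an aperture
at -X and a bounce at the wall X. The strip left of -X mirrors the one right of X, whose height
range the bouncing point misses. -/
theorem glue_injective_of_arrival {e e' : ℝ × ℝ}
    (he : -halfHeight p (⌈e.1⌉ - 1) < e.2 ∧ e.2 ≤ halfHeight p (⌈e.1⌉ - 1))
    (he' : -halfHeight p (⌈e'.1⌉ - 1) < e'.2 ∧ e'.2 ≤ halfHeight p (⌈e'.1⌉ - 1))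
    (h : glue p e = glue p e') : e = e' := by
  obtain ⟨X, Y⟩ := e
  obtain ⟨X', Y'⟩ := e'
  rw [glue, glue] at h
  dsimp only at h he he'
  have hmem : ∀ {H w : ℝ}, -H < w ∧ w ≤ H → -H ≤ (if w = H then -w else w) ∧
      (if w = H then -w else w) < H := by
    intro H w hw
    split_ifs with hwH
    · constructor <;> linarith
    · exact ⟨hw.1.le, lt_of_le_of_ne hw.2 hwH⟩
  have hinj : ∀ {H w w' : ℝ}, -H < w ∧ w ≤ H → -H < w' ∧ w' ≤ H →
      (if w = H then -w else w) = (if w' = H then -w' else w') → w = w' := by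
    intro H w w' hw hw' hww
    split_ifs at hww <;> linarith
  have hy := hmem he
  have hy' := hmem he'
  have hX : ∀ {X₁ X₂ y₁ y₂ : ℝ}, -halfHeight p (⌈X₁⌉ - 1) ≤ y₁ ∧ y₁ < halfHeight p (⌈X₁⌉ - 1) →
      -halfHeight p (⌈X₂⌉ - 1) ≤ y₂ ∧ y₂ < halfHeight p (⌈X₂⌉ - 1) →
      ¬ (-halfHeight p ⌊X₂⌋ ≤ y₂ ∧ y₂ < halfHeight p ⌊X₂⌋) → X₁ = -X₂ → y₁ ≠ y₂ := by
    rintro X₁ X₂ y₁ y₂ h1 h2 h3 rfl rfl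
    have h4 : ⌈X₂⌉ - 1 ≠ ⌊X₂⌋ := fun h => h3 (h ▸ h2)
    have h5 : ⌈X₂⌉ = ⌊X₂⌋ := by
      have := Int.ceil_le_floor_add_one X₂
      have := Int.floor_le_ceil X₂
      omega
    rw [Int.ceil_neg, show -⌊X₂⌋ - 1 = -(⌊X₂⌋ + 1) by ring, halfHeight_neg] at h1
    exact h3 h1
  have hyy : X = X' → (if Y = halfHeight p (⌈X⌉ - 1) then -Y else Y) =
      (if Y' = halfHeight p (⌈X'⌉ - 1) then -Y' else Y') → Y = Y' := by
    rintro rfl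
    exact hinj he he'
  generalize (if Y = halfHeight p (⌈X⌉ - 1) then -Y else Y) = y at h hy hyy
  generalize (if Y' = halfHeight p (⌈X'⌉ - 1) then -Y' else Y') = y' at h hy' hyy
  split_ifs at h with c c' c'
  all_goals simp only [Prod.mk.injEq] at h
  · rw [hyy h.1 h.2, h.1]
  · exact absurd h.2 (hX hy hy' c' h.1)
  · exact absurd h.2.symm (hX hy' hy c h.1.symm)
  · rw [hyy (neg_injective h.1) h.2, neg_injective h.1]

theorem arrival_mem (hc : 0 < Real.cos θ) (hs : 0 < Real.sin θ) {e : ℝ × ℝ} {ε : ℝ} (hε : 0 < ε)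
    (h : ∀ r : ℝ, 0 < r → r < ε → e - r • direction θ ∈ surface p) :
    -halfHeight p (⌈e.1⌉ - 1) < e.2 ∧ e.2 ≤ halfHeight p (⌈e.1⌉ - 1) := by
  obtain ⟨X, Y⟩ := e
  dsimp only
  have hX1 := Int.ceil_lt_add_one X
  have hX2 := Int.le_ceil X
  obtain ⟨δ, hδ0, hδ⟩ : ∃ δ > 0, ∀ r : ℝ, 0 < r → r < δ →
      -halfHeight p (⌈X⌉ - 1) ≤ Y - r * Real.sin θ ∧
        Y - r * Real.sin θ < halfHeight p (⌈X⌉ - 1) := by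
    refine ⟨min ε ((X + 1 - ⌈X⌉) / Real.cos θ), lt_min hε (div_pos (by linarith) hc),
      fun r hr0 hr => ?_⟩
    obtain ⟨hr1, hr2⟩ := lt_min_iff.1 hr
    rw [lt_div_iff₀ hc] at hr2
    have hrc : 0 < r * Real.cos θ := mul_pos hr0 hc
    have hfl : ⌊X - r * Real.cos θ⌋ = ⌈X⌉ - 1 := by
      rw [Int.floor_eq_iff]
      push_cast
      constructor <;> linarith
    have := h r hr0 hr1
    simp only [direction, Prod.smul_mk, smul_eq_mul, Prod.mk_sub_mk, surface,
      Set.mem_ofPred_eq, hfl] at this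
    exact this
  constructor
  · have h1 := (hδ (δ / 2) (by linarith) (by linarith)).1
    have h2 : 0 < δ / 2 * Real.sin θ := mul_pos (by linarith) hs
    linarith
  · by_contra! hlt
    have hr0 : 0 < min (δ / 2) ((Y - halfHeight p (⌈X⌉ - 1)) / Real.sin θ) :=
      lt_min (by linarith) (div_pos (by linarith) hs)
    have h1 := (hδ _ hr0 ((min_le_left _ _).trans_lt (by linarith))).2
    have h2 := (le_div_iff₀ hs).1 (min_le_right (δ / 2)
      ((Y - halfHeight p (⌈X⌉ - 1)) / Real.sin θ))
    linarith

/-- The flow is deterministic, in the future and in the past. -/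
theorem IsTrajectory.eq_of_apply_eq (hc : 0 < Real.cos θ) (hs : 0 < Real.sin θ) {γ γ' : ℝ → ℝ × ℝ}
    (h : IsTrajectory p θ γ) (h' : IsTrajectory p θ γ') {t₀ : ℝ} (h0 : γ t₀ = γ' t₀) : γ = γ' := by
  -- Coincidence at t spreads to a neighbourhood of t, and so does its failure; ℝ is connected.
  have key : IsLocallyConstant fun t => γ t = γ' t := by
    rw [IsLocallyConstant.iff_eventually_eq]
    intro t
    obtain ⟨-, ⟨ε₁, hε₁, h1⟩, ε₂, hε₂, e, h2, hge⟩ := h t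
    obtain ⟨-, ⟨ε₁', hε₁', h1'⟩, ε₂', hε₂', e', h2', hge'⟩ := h' t
    have hee : γ t = γ' t ↔ e = e' := by
      rw [hge, hge']
      refine ⟨fun hg => glue_injective_of_arrival ?_ ?_ hg, fun hg => by rw [hg]⟩
      · exact arrival_mem hc hs hε₂ fun r hr0 hr => h2 r hr0 hr ▸ (h (t - r)).1
      · exact arrival_mem hc hs hε₂' fun r hr0 hr => h2' r hr0 hr ▸ (h' (t - r)).1
    filter_upwards [Ioo_mem_nhds (sub_lt_self t (lt_min hε₂ hε₂'))
      (lt_add_of_pos_right t (lt_min hε₁ hε₁'))] with r hr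
    rcases le_or_gt t r with htr | htr
    · obtain ⟨s, rfl⟩ : ∃ s, r = t + s := ⟨r - t, by ring⟩
      obtain ⟨hr1, hr2⟩ := lt_min_iff.1 (show s < min ε₁ ε₁' by linarith [hr.2])
      rw [h1 s (by linarith) hr1, h1' s (by linarith) hr2, add_left_inj]
    · obtain ⟨s, rfl⟩ : ∃ s, r = t - s := ⟨t - r, by ring⟩
      obtain ⟨hr1, hr2⟩ := lt_min_iff.1 (show s < min ε₂ ε₂' by linarith [hr.1])
      rw [h2 s (by linarith) hr1, h2' s (by linarith) hr2, sub_left_inj, hee]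
  funext t
  have := key.apply_eq_of_preconnectedSpace t t₀
  exact this ▸ h0

theorem IsTrajectory.comp_add {γ : ℝ → ℝ × ℝ} (h : IsTrajectory p θ γ) (c : ℝ) :
    IsTrajectory p θ fun t => γ (t + c) := by
  intro t
  obtain ⟨h1, ⟨ε₁, hε₁, h2⟩, ε₂, hε₂, e, h3, hge⟩ := h (t + c)
  refine ⟨h1, ⟨ε₁, hε₁, fun s hs hs' => ?_⟩, ε₂, hε₂, e, fun s hs hs' => ?_, hge⟩
  · dsimp only
    rw [add_right_comm]
    exact h2 s hs hs'
  · dsimp only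
    rw [sub_add_eq_add_sub]
    exact h3 s hs hs'

/-- Every trajectory is an orbit of the flow. -/
theorem IsTrajectory.exists_eq_flow (hpos : ∀ n, 0 < p n) (hc : 0 < Real.cos θ)
    (hs : 0 < Real.sin θ) {γ : ℝ → ℝ × ℝ} (h : IsTrajectory p θ γ) :
    ∃ (s : State p) (c : ℝ), γ = fun t => flow hpos θ s (t + c) := by
  have h0 := (h 0).1
  obtain ⟨⟨X, Y⟩, hγ⟩ : ∃ z, γ 0 = z := ⟨_, rfl⟩
  rw [hγ] at h0
  set u := Int.fract X with hu
  have hX : (⌊X⌋ : ℝ) + u = X := Int.floor_add_fract X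
  let s : State p := ⟨(⌊X⌋, wrap (halfHeight p ⌊X⌋) (Y - u * Real.tan θ)),
    wrap_mem (halfHeight_pos hpos _) _⟩
  refine ⟨s, u / Real.cos θ, h.eq_of_apply_eq hc hs
    ((isTrajectory_flow hpos hc hs s).comp_add _) (t₀ := 0) ?_⟩
  rw [hγ, flow_eq hpos s (u := u) (N := 0) (by rw [zero_add, div_mul_cancel₀ _ hc.ne']; simp)
    (Int.fract_nonneg _) (Int.fract_lt_one _), zpow_zero, Equiv.Perm.one_apply, glide]
  obtain ⟨z, hz⟩ := exists_wrap_eq (halfHeight p ⌊X⌋) (Y - u * Real.tan θ)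
  refine Prod.ext hX.symm (wrap_eq h0 (-z) ?_).symm
  rw [show s.1.2 = _ from hz]
  push_cast
  ring

/-! ### Escape orbits cross all apertures directly -/

theorem halfHeight_le_succ (hanti : ∀ n, p (n + 1) ≤ p n) {k : ℤ} (hk : k < 0) :
    halfHeight p k ≤ halfHeight p (k + 1) := by
  obtain ⟨n, rfl⟩ := Int.eq_negSucc_of_lt_zero hk
  cases n with
  | zero => exact le_rfl
  | succ n => exact hanti n

theorem step_snd (hpos : ∀ n, 0 < p n) (α : ℝ) (s : State p) :
    (step hpos α s).1.2 = wrap (halfHeight p s.1.1) (s.1.2 + α) := by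
  rw [coe_step]
  split_ifs <;> rfl

theorem step_fst (hpos : ∀ n, 0 < p n) (hanti : ∀ n, p (n + 1) ≤ p n) (α : ℝ) (s : State p) :
    (step hpos α s).1.1 = s.1.1 + 1 ∨
      (0 ≤ s.1.1 ∧ (step hpos α s).1.1 = -(s.1.1 + 1)) := by
  rw [coe_step]
  split_ifs with h
  · exact Or.inl rfl
  · refine Or.inr ⟨?_, rfl⟩
    by_contra! hneg
    have h1 := halfHeight_le_succ hanti hneg
    have h2 := wrap_mem (halfHeight_pos hpos s.1.1) (s.1.2 + α)
    exact h ⟨by linarith, by linarith⟩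

theorem step_zpow_succ (hpos : ∀ n, 0 < p n) (α : ℝ) (s : State p) (N : ℤ) :
    (step hpos α ^ (N + 1)) s = step hpos α ((step hpos α ^ N) s) := by
  rw [add_comm, zpow_add, zpow_one, Equiv.Perm.mul_apply]

theorem flow_div_cos (hpos : ∀ n, 0 < p n) (hc : 0 < Real.cos θ) (s : State p) (N : ℤ) :
    flow hpos θ s (N / Real.cos θ) = ((((step hpos (Real.tan θ) ^ N) s).1.1 : ℝ),
      ((step hpos (Real.tan θ) ^ N) s).1.2) := by
  rw [flow_eq hpos s (u := 0) (N := N) (by rw [div_mul_cancel₀ _ hc.ne', add_zero]) le_rfl one_pos,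
    glide_zero]

theorem range_flow_zpow (hpos : ∀ n, 0 < p n) (hc : 0 < Real.cos θ) (s : State p) (N : ℤ) :
    Set.range (flow hpos θ ((step hpos (Real.tan θ) ^ N) s)) = Set.range (flow hpos θ s) := by
  have : flow hpos θ ((step hpos (Real.tan θ) ^ N) s) =
      flow hpos θ s ∘ Equiv.addRight (N / Real.cos θ) := funext fun t => flow_zpow hpos hc s N t
  rw [this, (Equiv.surjective _).range_comp]

/-- The orbit that leaves the state `s` passes directly through all the apertures. -/
def EscapesDirectly (hpos : ∀ n, 0 < p n) (α : ℝ) (s : State p) : Prop :=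
  ∀ j : ℕ, ((step hpos α ^ (j : ℤ)) s).1.1 = j

theorem exists_escapesDirectly (hpos : ∀ n, 0 < p n) (hanti : ∀ n, p (n + 1) ≤ p n)
    (hc : 0 < Real.cos θ) (s : State p)
    (h : Tendsto (fun t => |(flow hpos θ s t).1|) atTop atTop) :
    ∃ N : ℤ, EscapesDirectly hpos (Real.tan θ) ((step hpos (Real.tan θ) ^ N) s) := by
  set k : ℤ → ℤ := fun N => ((step hpos (Real.tan θ) ^ N) s).1.1 with hk
  have hstep : ∀ N, k (N + 1) = k N + 1 ∨ (0 ≤ k N ∧ k (N + 1) = -(k N + 1)) := by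
    intro N
    simp only [hk, step_zpow_succ]
    exact step_fst hpos hanti _ _
  obtain ⟨T, hT⟩ := eventually_atTop.1 (h.eventually_gt_atTop 0)
  obtain ⟨N₁, hN₁⟩ := exists_int_gt (T * Real.cos θ)
  have hne : ∀ N ≥ N₁, k N ≠ 0 := by
    intro N hN h0
    have hNr : (N₁ : ℝ) ≤ N := by exact_mod_cast hN
    have := hT (N / Real.cos θ) (by rw [le_div_iff₀ hc]; linarith)
    rw [flow_div_cos hpos hc] at this
    have h0' : ((step hpos (Real.tan θ) ^ N) s).1.1 = 0 := h0
    simp [h0'] at this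
  have hpos' : ∀ N ≥ N₁, 0 < k N := by
    intro N hN
    by_contra! hle
    -- From a negative index the orbit climbs by one at each step and would meet 0.
    have hneg : ∀ i : ℕ, k (N + i) = k N + i ∧ k (N + i) < 0 := by
      intro i
      induction i with
      | zero =>
        have := hne N hN
        push_cast
        rw [add_zero, add_zero]
        exact ⟨rfl, by omega⟩
      | succ i ih =>
        have h1 := hstep (N + i)
        have h2 := hne (N + i + 1) (by omega)
        push_cast
        rw [← add_assoc]
        omega
    have := hneg (-k N).toNat
    omega
  have hup : ∀ i : ℕ, k (N₁ + i) = k N₁ + i := by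
    intro i
    induction i with
    | zero => simp
    | succ i ih =>
      have h1 := hstep (N₁ + i)
      have h2 := hpos' (N₁ + i + 1) (by omega)
      push_cast
      rw [← add_assoc]
      omega
  -- A reflection lands at a negative index, so a positive index can only come from its predecessor;
  -- this leads back to X = 0 at step `N₁ - k N₁`.
  have hdown : ∀ i : ℕ, (i : ℤ) ≤ k N₁ → k (N₁ - i) = k N₁ - i := by
    intro i
    induction i with
    | zero => simp
    | succ i ih =>
      intro hi
      have h1 := hstep (N₁ - i - 1)
      rw [sub_add_cancel] at h1
      push_cast at hi ⊢
      have h2 := ih (by omega)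
      rw [← sub_sub]
      omega
  refine ⟨N₁ - k N₁, fun j => ?_⟩
  rw [← Equiv.Perm.mul_apply, ← zpow_add]
  change k (j + (N₁ - k N₁)) = j
  have h0 := hpos' N₁ le_rfl
  rcases le_total (j : ℤ) (k N₁) with hj | hj
  · have := hdown (k N₁ - j).toNat (by omega)
    rw [show (j : ℤ) + (N₁ - k N₁) = N₁ - (k N₁ - j).toNat by omega, this]
    omega
  · have := hup (j - k N₁).toNat
    rw [show (j : ℤ) + (N₁ - k N₁) = N₁ + (j - k N₁).toNat by omega, this]
    omega

theorem EscapesDirectly.abs_le_and_linked {hpos : ∀ n, 0 < p n} {α : ℝ} {s : State p}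
    (h : EscapesDirectly hpos α s) (j : ℕ) :
    |((step hpos α ^ (j : ℤ)) s).1.2| ≤ p j ∧
      Linked p α (fun j : ℕ => ((step hpos α ^ (j : ℤ)) s).1.2) j := by
  have hj : halfHeight p ((step hpos α ^ (j : ℤ)) s).1.1 = p j := by rw [h j]; rfl
  constructor
  · have := ((step hpos α ^ (j : ℤ)) s).2
    rw [hj] at this
    exact abs_le.2 ⟨this.1, this.2.le⟩
  · obtain ⟨z, hz⟩ := exists_wrap_eq (p j) (((step hpos α ^ (j : ℤ)) s).1.2 + α)
    refine ⟨z, ?_⟩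
    dsimp only
    rw [Nat.cast_succ, step_zpow_succ, step_snd, hj, hz]

theorem exists_state_escapesDirectly (hpos : ∀ n, 0 < p n) (hanti : ∀ n, p (n + 1) ≤ p n) {α : ℝ}
    {y : ℕ → ℝ} (hy : ∀ k, |y k| < p k ∧ Linked p α y k) :
    ∃ s : State p, EscapesDirectly hpos α s := by
  have hy' : ∀ k, -p k ≤ y k ∧ y k < p k := fun k =>
    ⟨(abs_lt.1 (hy k).1).1.le, (abs_lt.1 (hy k).1).2⟩
  let s : State p := ⟨(0, y 0), hy' 0⟩
  have key : ∀ j : ℕ, ((step hpos α ^ (j : ℤ)) s).1 = ((j : ℤ), y j) := by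
    intro j
    induction j with
    | zero => rfl
    | succ j ih =>
      obtain ⟨z, hz⟩ := (hy j).2
      have h1 := hy' (j + 1)
      have h2 := hanti j
      have hw : wrap (halfHeight p (j : ℤ)) (y j + α) = y (j + 1) :=
        wrap_eq (h := p j) ⟨by linarith, by linarith⟩ z hz
      rw [Nat.cast_succ, step_zpow_succ, coe_step, ih]
      dsimp only
      rw [hw, if_pos]
      exact h1
  exact ⟨s, fun j => by rw [key]⟩

theorem EscapesDirectly.tendsto {hpos : ∀ n, 0 < p n} (hc : 0 < Real.cos θ) {s : State p}
    (h : EscapesDirectly hpos (Real.tan θ) s) :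
    Tendsto (fun t => (fold (flow hpos θ s t)).1) atTop atTop := by
  refine (tendsto_id.atTop_mul_const hc).congr' ?_
  filter_upwards [eventually_ge_atTop 0] with t ht
  have h0 : 0 ≤ t * Real.cos θ := mul_nonneg ht hc.le
  obtain ⟨n, hn⟩ := Int.eq_ofNat_of_zero_le (Int.floor_nonneg.2 h0)
  have hfl := Int.floor_add_fract (t * Real.cos θ)
  rw [fold, flow, glide, hn, h n]
  rw [hn] at hfl
  push_cast at hfl ⊢
  rw [hfl, abs_of_nonneg h0, id]

/-! ### Avoiding the vertices -/

theorem halfHeight_mem_closure (p : ℕ → ℝ) (k : ℤ) :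
    halfHeight p k ∈ AddSubgroup.closure (Set.range p) := by
  cases k <;> exact AddSubgroup.subset_closure ⟨_, rfl⟩

/-- Modulo the group generated by the p n every step adds α, whether or not it ends in a reflection.
-/
theorem step_zpow_snd_sub_mem (hpos : ∀ n, 0 < p n) (α : ℝ) (s : State p) (i : ℕ) :
    ((step hpos α ^ (i : ℤ)) s).1.2 - s.1.2 - i * α ∈ AddSubgroup.closure (Set.range p) := by
  induction i with
  | zero => simp
  | succ i ih =>
    set σ := (step hpos α ^ (i : ℤ)) s with hσ
    obtain ⟨z, hz⟩ := exists_wrap_eq (halfHeight p σ.1.1) (σ.1.2 + α)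
    rw [Nat.cast_succ, step_zpow_succ, step_snd, ← hσ, hz]
    have h := add_mem ih (zsmul_mem (halfHeight_mem_closure p σ.1.1) (2 * z))
    convert h using 1
    push_cast
    rw [zsmul_eq_mul]
    push_cast
    ring

theorem countable_closure_range (p : ℕ → ℝ) :
    (AddSubgroup.closure (Set.range p) : Set ℝ).Countable := by
  have h : AddSubgroup.closure (Set.range p) ≤
      (Finsupp.linearCombination ℤ p).toAddMonoidHom.range := by
    rw [AddSubgroup.closure_le]
    rintro _ ⟨n, rfl⟩
    exact ⟨Finsupp.single n 1, by simp⟩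
  exact (Set.countable_range _).mono h

theorem snd_mem_closure_of_fold_mem_vertices {z : ℝ × ℝ} (hz : fold z ∈ vertices p) :
    (∃ k : ℤ, z.1 = k) ∧ z.2 ∈ AddSubgroup.closure (Set.range p) := by
  have hx : ∀ n : ℤ, |z.1| = n → ∃ k : ℤ, z.1 = k := by
    intro n hn
    rcases abs_choice z.1 with h | h
    · exact ⟨n, by rw [← hn, h]⟩
    · exact ⟨-n, by push_cast; rw [← hn, h, neg_neg]⟩
  have hy : |z.2| ∈ AddSubgroup.closure (Set.range p) →
      z.2 ∈ AddSubgroup.closure (Set.range p) := by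
    intro h
    rcases abs_choice z.2 with h' | h' <;> rw [h'] at h
    · exact h
    · exact neg_mem_iff.1 h
  have hp : ∀ n, p n ∈ AddSubgroup.closure (Set.range p) := fun n =>
    AddSubgroup.subset_closure ⟨n, rfl⟩
  simp only [fold, vertices, Set.mem_union, Set.mem_insert_iff, Set.mem_singleton_iff,
    Set.mem_ofPred_eq, Prod.mk.injEq] at hz
  rcases hz with (⟨h1, h2⟩ | ⟨h1, h2⟩) | ⟨n, ⟨h1, h2⟩ | ⟨h1, h2⟩⟩
  · exact ⟨hx 0 (by simpa using h1), hy (h2 ▸ zero_mem _)⟩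
  · exact ⟨hx 0 (by simpa using h1), hy (h2 ▸ hp _)⟩
  · exact ⟨hx (n + 1) (by simpa using h1), hy (h2 ▸ hp _)⟩
  · exact ⟨hx (n + 1) (by simpa using h1), hy (h2 ▸ hp _)⟩

theorem EscapesDirectly.fold_notMem_vertices {hpos : ∀ n, 0 < p n} {s : State p}
    (h : EscapesDirectly hpos (Real.tan θ) s)
    (hθ : ∀ t ∈ AddSubgroup.closure (Set.range p), ∀ n i : ℕ, 1 ≤ i →
      Real.tan θ ∉ ⋂ j, corridor p j n i t) (t : ℝ) :
    fold (flow hpos θ s t) ∉ vertices p := by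
  intro hv
  set α := Real.tan θ with hα
  obtain ⟨⟨k, hk⟩, hy⟩ := snd_mem_closure_of_fold_mem_vertices hv
  rw [flow, glide] at hk hy
  set N := ⌊t * Real.cos θ⌋
  set u := Int.fract (t * Real.cos θ)
  set σ := (step hpos α ^ N) s with hσ
  dsimp only at hk hy
  have hu : u = 0 := by
    have h1 : ((k - σ.1.1 : ℤ) : ℝ) = u := by push_cast; linarith
    have h2 : (-1 : ℤ) < k - σ.1.1 := by
      rw [← Int.cast_lt (R := ℝ), h1]
      push_cast
      linarith [Int.fract_nonneg (t * Real.cos θ)]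
    have h3 : k - σ.1.1 < 1 := by
      rw [← Int.cast_lt (R := ℝ), h1]
      push_cast
      exact Int.fract_lt_one (t * Real.cos θ)
    rw [← h1, show k - σ.1.1 = 0 by omega, Int.cast_zero]
  rw [hu, zero_mul, add_zero, wrap_eq σ.2 0 (by simp)] at hy
  -- The vertex may lie in the past (N < 0): i is at least 1 and large enough for the level n = i +
  -- N to be nonnegative.
  obtain ⟨i, n, hi, hin⟩ : ∃ i n : ℕ, 1 ≤ i ∧ (i : ℤ) + N = n :=
    ⟨(1 + |N|).toNat, (1 + |N| + N).toNat, by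
      have := abs_nonneg N
      omega, by
      have := abs_nonneg N
      have := neg_abs_le N
      omega⟩
  have hmem := add_mem (step_zpow_snd_sub_mem hpos α σ i) hy
  rw [hσ, ← Equiv.Perm.mul_apply, ← zpow_add, hin, ← hσ] at hmem
  refine hθ _ hmem n i hi (Set.mem_iInter.2 fun j => ?_)
  exact mem_corridor_of_linked (c := fun j : ℕ => ((step hpos α ^ (j : ℤ)) s).1.2)
    (fun l _ _ => (h.abs_le_and_linked l).1) (fun l _ _ => (h.abs_le_and_linked l).2) (by ring)

/-! ### From slopes to directions, and conclusion -/

/-- The differentiable map arctan takes null sets to null sets. -/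
theorem ae_tan {P : ℝ → Prop} (h : ∀ᵐ α : ℝ, P α) :
    ∀ᵐ θ ∂(volume.restrict (Set.Ioo (0 : ℝ) (Real.pi / 2))), P (Real.tan θ) := by
  rw [ae_restrict_iff' measurableSet_Ioo, ae_iff]
  refine measure_mono_null (t := Real.arctan '' {α | ¬ P α}) ?_
    (addHaar_image_eq_zero_of_differentiableOn_of_addHaar_eq_zero volume
      Real.differentiable_arctan.differentiableOn (ae_iff.1 h))
  intro θ hθ
  simp only [Set.mem_ofPred_eq, Classical.not_imp] at hθ
  exact ⟨Real.tan θ, hθ.2, Real.arctan_tan (by linarith [hθ.1.1, Real.pi_pos]) hθ.1.2⟩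

end StepBilliard

open StepBilliard in
theorem mainTheorem6 (p : ℕ → ℝ) (lam : ℝ)
    (hpos : ∀ n, 0 < p n)
    (hlam : 0 < lam) (hlam' : lam < (Real.sqrt 6 - 1) / 5)
    (hp : ∀ n, p (n + 1) ≤ lam * p n) :
    ∀ᵐ θ ∂(MeasureTheory.volume.restrict (Set.Ioo (0 : ℝ) (Real.pi / 2))),
      ∃ η : Set (ℝ × ℝ), StepBilliard.IsEscapeOrbit p θ η ∧
        (∀ η' : Set (ℝ × ℝ), StepBilliard.IsEscapeOrbit p θ η' → η' = η) ∧
        ∀ z ∈ η, StepBilliard.fold z ∉ StepBilliard.vertices p := by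
  have hlam2 : lam < 29 / 100 := by
    -- The value 2.45 gives (2.45 - 1) / 5 = 0.29 exactly.
    have : Real.sqrt 6 < 245 / 100 := by
      rw [Real.sqrt_lt' (by norm_num)]
      norm_num
    linarith
  have hp' : ∀ n, p (n + 1) ≤ 29 / 100 * p n := fun n =>
    (hp n).trans (mul_le_mul_of_nonneg_right hlam2.le (hpos n).le)
  have hanti : ∀ n, p (n + 1) ≤ p n := fun n => by linarith [hp' n, hpos n]
  have h0 := tendsto_zero hpos hp'
  have hcount := countable_closure_range p
  have hrays : ∀ᵐ α : ℝ, ∀ t ∈ AddSubgroup.closure (Set.range p), ∀ n i : ℕ, 1 ≤ i →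
      α ∉ ⋂ j, corridor p j n i t := by
    refine (ae_ball_iff hcount).2 fun t _ => ae_all_iff.2 fun n => ae_all_iff.2 fun i => ?_
    by_cases hi : 1 ≤ i
    · have := measure_eq_zero_iff_ae_notMem.1 (volume_iInter_corridor hpos hp' n i t hi)
      filter_upwards [this] with α hα _ using hα
    · exact Eventually.of_forall fun α h => absurd h hi
  filter_upwards [ae_tan hrays, ae_tan (ae_frequently_forall_notMem_cornerRays hpos hp'),
    ae_restrict_mem measurableSet_Ioo] with θ hθ hfreq hmem
  have hc : 0 < Real.cos θ := Real.cos_pos_of_mem_Ioo ⟨by linarith [hmem.1, Real.pi_pos], hmem.2⟩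
  have hs : 0 < Real.sin θ := Real.sin_pos_of_pos_of_lt_pi hmem.1 (by linarith [hmem.2, Real.pi_pos])
  have hunsplit : ∃ᶠ m in Filter.atTop, ∃ c, IsUnsplit p (Real.tan θ) 0 m c :=
    hfreq.mono fun m hm => exists_isUnsplit hpos hm (Nat.zero_le m)
  obtain ⟨y, hy⟩ := exists_linked hpos h0 hunsplit
  obtain ⟨s, hesc⟩ := exists_state_escapesDirectly hpos hanti hy
  refine ⟨Set.range (flow hpos θ s), ⟨_, isTrajectory_flow hpos hc hs s, rfl, hesc.tendsto hc⟩,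
    ?_, ?_⟩
  · rintro η ⟨γ, hγ, rfl, hlim⟩
    obtain ⟨s', c, rfl⟩ := hγ.exists_eq_flow hpos hc hs
    have hlim' : Filter.Tendsto (fun t => |(flow hpos θ s' t).1|) Filter.atTop Filter.atTop := by
      have := hlim.comp (Filter.tendsto_atTop_add_const_right _ (-c) Filter.tendsto_id)
      refine this.congr fun t => ?_
      simp [fold]
    obtain ⟨N, hN⟩ := exists_escapesDirectly hpos hanti hc s' hlim'
    -- Both states lie on X = 0, and their chains start at the same height by uniqueness.
    have hstate : (step hpos (Real.tan θ) ^ N) s' = s := by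
      refine Subtype.ext (Prod.ext ?_ ?_)
      · have h1 := hN 0
        have h2 := hesc 0
        exact h1.trans h2.symm
      · exact eq_of_linked hpos h0 hunsplit (fun k => (hN.abs_le_and_linked k).1)
          (fun k => (hN.abs_le_and_linked k).2) (fun k => (hesc.abs_le_and_linked k).1)
          (fun k => (hesc.abs_le_and_linked k).2)
    rw [← hstate, range_flow_zpow hpos hc]
    exact (Equiv.addRight c).surjective.range_comp (flow hpos θ s')
  · rintro _ ⟨t, rfl⟩
    exact hesc.fold_notMem_vertices hθ t
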